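/- A biquandle is a set $B$ with binary operations $\circ,\ast$ such that: (1) $x\circ x=x\ast x$ for all $x$; (2) for every $y$ the maps $x\mapsto x\circ y$ and $x\mapsto x\ast y$ are bijections of $B$; (3) the map $(x,y)\mapsto(x\circ y,\,y\ast x)$ is a bijection of $B\times B$; (4) for all $x,y,z$ $$(x\circ z)\circ(y\circ z)=(x\circ y)\circ(z\ast y),\quad (x\circ z)\ast(y\circ z)=(x\ast y)\circ(z\ast y),\quad (x\ast z)\ast(y\ast z)=(x\ast y)\ast(z\circ y).$$ A virtual biquandle $(B,f)$ is a biquandle $B$ with an automorphism $f$, i.e. a bijection $f:B\to B$ with $f(x\circ y)=f(x)\circ f(y)$ and $f(x\ast y)=f(x)\ast f(y)$. Let $D$ be a diagram of an oriented virtual link: a generic immersion of finitely many oriented circles in the plane whose finitely many double points are marked as classical crossings (with over/under information) or virtual crossings. The short arcs of $D$ are the pieces between consecutive crossings of any kind. The long arcs are the pieces between consecutive classical crossings, passing straight through virtual ones. A component without crossings counts as one short arc, and a component without classical crossings counts as one long arc. At each crossing, every one of the two strands is divided into the part to the left and the part to the right of the other (oriented) strand. A colouring of $D$ with a biquandle $B$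 is a map from the long arcs of $D$ to $B$ such that at every classical crossing, if the left parts of the undercrossing and of the overcrossing strand have colours $x$ and $y$, then their right parts have colours $x\circ y$ and $y\ast x$ respectively. A colouring of $D$ with a virtual biquandle $(B,f)$ is a map from the short arcs of $D$ to $B$ that satisfies the same rule at every classical crossing and such that at every virtual crossing, if the left part of a strand has colour $x$, then its right part has colour $f(x)$ (for each of the two strands). Denote the sets of colourings by $Col_B(D)$ and $Col_{(B,f)}(D)$. **Theorem.** Let $(B,f)$ be a virtual biquandle, and put $x\circ_f y=f^{-1}(x)\circ f^{-1}(y)$ and $x\ast_f y=f^{-1}(x)\ast f^{-1}(y)$. 1. The set $B$ with the operations $\circ_f$ and $\ast_f$ is a biquandle, denoted $B_f$. 2. For every diagram $D$ of an oriented virtual link there is a bijection between the colouring sets $Col_{(B,f)}(D)$ and $Col_{B_f}(D)$. -/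

import Mathlib

/-! ### Biquandles and virtual biquandles -/

/-- Two binary operations `x ∘ y = circ x y` and `x ∗ y = ast x y` that make the set `B`
a biquandle. -/
structure IsBiquandle {B : Type*} (circ ast : B → B → B) : Prop where
  diag : ∀ x, circ x x = ast x x
  circ_bijective : ∀ y, Function.Bijective (fun x => circ x y)
  ast_bijective : ∀ y, Function.Bijective (fun x => ast x y)
  pair_bijective : Function.Bijective (fun p : B × B => (circ p.1 p.2, ast p.2 p.1))
  exchange_circ_circ : ∀ x y z,
    circ (circ x z) (circ y z) = circ (circ x y) (ast z y)
  exchange_circ_ast : ∀ x y z,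
    ast (circ x z) (circ y z) = circ (ast x y) (ast z y)
  exchange_ast_ast : ∀ x y z,
    ast (ast x z) (ast y z) = ast (ast x y) (circ z y)

/-- `(B, f)` is a virtual biquandle: `B` is a biquandle and the bijection `f` preserves both
operations, that is, `f` is an automorphism of `B`. -/
structure IsVirtualBiquandle {B : Type*} (circ ast : B → B → B) (f : B ≃ B) : Prop where
  isBiquandle : IsBiquandle circ ast
  map_circ : ∀ x y, f (circ x y) = circ (f x) (f y)
  map_ast : ∀ x y, f (ast x y) = ast (f x) (f y)

/-- The twisted operation `(x, y) ↦ f⁻¹(x) · f⁻¹(y)` of a binary operation. -/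
def twistOp {B : Type*} (f : B ≃ B) (op : B → B → B) : B → B → B :=
  fun x y => op (f.symm x) (f.symm y)

/-! ### Oriented virtual link diagrams

An oriented virtual link diagram is a generic immersion of finitely many oriented circles in the
plane whose double points (crossings) are marked as virtual or classical, with over/under
information at the classical ones. It is recorded by its combinatorial map. Every crossing is
turned so that both strands run upwards:

```
      NW     NE
        \   /
         \ /
          x
         / \
        /   \
      SW     SE
```

Thus one strand runs from SW to NE and the other from SE to NW. -/

/-- The two strands at a crossing, both running upwards. -/
inductive Strand
  /-- The strand from the south-west to the north-east end. -/
  | swne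
  /-- The strand from the south-east to the north-west end. -/
  | senw

/-- The other strand at the same crossing. -/
def Strand.other : Strand → Strand
  | .swne => .senw
  | .senw => .swne

/-- The two ends of a strand at a crossing: it comes in (SW, SE) and goes out (NE, NW). -/
inductive StrandEnd
  | incoming
  | outgoing

/-- The combinatorial map of a finite family of oriented closed curves on a closed oriented
surface whose only singularities are finitely many transversal double points, every curve passing
through at least one of them. A pair `(c, s)` stands for the passage along the strand `s` of the
crossing `c`, and also for the edge (short arc) which starts at the outgoing end of that strand.
This edge ends at the incoming end of the passage `next (c, s)`. -/
structure CurveMap where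
  Crossing : Type
  finite : Finite Crossing
  next : Equiv.Perm (Crossing × Strand)

namespace CurveMap

/-- Half-edges (darts): the four ends SW, SE, NE, NW at all crossings. -/
abbrev Dart (G : CurveMap) : Type := (G.Crossing × Strand) × StrandEnd

/-- The next half-edge counterclockwise at the same crossing: SW → SE → NE → NW → SW. -/
def rotate (G : CurveMap) : G.Dart → G.Dart
  | ((c, .swne), .incoming) => ((c, .senw), .incoming)
  | ((c, .senw), .incoming) => ((c, .swne), .outgoing)
  | ((c, .swne), .outgoing) => ((c, .senw), .outgoing)
  | ((c, .senw), .outgoing) => ((c, .swne), .incoming)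

/-- The other half of the same edge. -/
def opposite (G : CurveMap) : G.Dart → G.Dart
  | (p, .outgoing) => (G.next p, .incoming)
  | (p, .incoming) => (G.next.symm p, .outgoing)

/-- The faces of the map: half-edges up to `d ∼ rotate (opposite d)`, which walks along the
boundary of a face. -/
def Face (G : CurveMap) : Type :=
  Quot (fun d e : G.Dart => e = G.rotate (G.opposite d))

/-- The connected components of the underlying 4-valent graph (not the link components). -/
def GraphComponent (G : CurveMap) : Type :=
  Quot (fun c d : G.Crossing => ∃ s t : Strand, G.next (c, s) = (d, t))

/-- The map is planar (every connected component has genus zero), by Euler's formula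
`V - E + F = 2 C`. -/
def IsPlanar (G : CurveMap) : Prop :=
  (Nat.card G.Crossing : ℤ) - Nat.card (G.Crossing × Strand) + Nat.card G.Face
    = 2 * Nat.card G.GraphComponent

end CurveMap

/-- The kind of a crossing. -/
inductive CrossingKind
  /-- A virtual crossing. -/
  | virt
  /-- A classical crossing with the given overcrossing strand. -/
  | classical (top : Strand)

/-- A diagram of an oriented virtual link: a planar 4-valent oriented map with a kind for every
crossing, and a number of circles without crossings. -/
structure VirtualDiagram extends CurveMap where
  planar : toCurveMap.IsPlanar
  kind : Crossing → CrossingKind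
  circles : ℕ

namespace VirtualDiagram

/-- The short arcs, whose ends are classical or virtual crossings: the edges of the map, and the
circles without crossings. -/
abbrev ShortArc (D : VirtualDiagram) : Type := (D.Crossing × Strand) ⊕ Fin D.circles

/-- The short arc that leaves the crossing `c` along the strand `s`. -/
def outArc (D : VirtualDiagram) (c : D.Crossing) (s : Strand) : D.ShortArc :=
  Sum.inl (c, s)

/-- The short arc that arrives at the crossing `c` along the strand `s`. -/
def inArc (D : VirtualDiagram) (c : D.Crossing) (s : Strand) : D.ShortArc :=
  Sum.inl (D.next.symm (c, s))

/-- The short arc at the western end (SW or NW) of the strand `s` at `c`: the part of the strand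
which lies to the left of the other strand. -/
def west (D : VirtualDiagram) (c : D.Crossing) : Strand → D.ShortArc
  | .swne => D.inArc c .swne
  | .senw => D.outArc c .senw

/-- The short arc at the eastern end (NE or SE) of the strand `s` at `c`: the part of the strand
which lies to the right of the other strand. -/
def east (D : VirtualDiagram) (c : D.Crossing) : Strand → D.ShortArc
  | .swne => D.outArc c .swne
  | .senw => D.inArc c .senw

/-- The long arcs, which pass straight through virtual crossings and end at classical ones:
short arcs are identified when one continues the other through a virtual crossing. A link
component without classical crossings is one (closed) long arc. -/
def LongArc (D : VirtualDiagram) : Type :=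
  Quot (fun a b : D.ShortArc =>
    ∃ c s, D.kind c = CrossingKind.virt ∧ a = D.inArc c s ∧ b = D.outArc c s)

/-- The long arc containing a short arc. -/
def longArc (D : VirtualDiagram) (a : D.ShortArc) : D.LongArc := Quot.mk _ a

/-- The colouring rule at a classical crossing `c` with overcrossing strand `o`, for colours of the
short arcs: if the western parts of the under- and overcrossing strands have the colours `x`
and `y`, then their eastern parts have the colours `x ∘ y` and `y ∗ x`. -/
def ClassicalRule {B : Type*} (circ ast : B → B → B) (D : VirtualDiagram) (col : D.ShortArc → B)
    (c : D.Crossing) (o : Strand) : Prop :=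
  col (D.east c o.other) = circ (col (D.west c o.other)) (col (D.west c o)) ∧
  col (D.east c o) = ast (col (D.west c o)) (col (D.west c o.other))

/-- The colouring rule at a virtual crossing `c`: if the western part of a strand has the
colour `x`, then its eastern part has the colour `f x`. -/
def VirtualRule {B : Type*} (f : B ≃ B) (D : VirtualDiagram) (col : D.ShortArc → B)
    (c : D.Crossing) : Prop :=
  ∀ s, col (D.east c s) = f (col (D.west c s))

/-- The colourings of (the long arcs of) `D` with the set `B` with the operations `circ`, `ast`. -/
def Colouring {B : Type*} (circ ast : B → B → B) (D : VirtualDiagram) : Type _ :=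
  {col : D.LongArc → B // ∀ c o, D.kind c = CrossingKind.classical o →
    ClassicalRule circ ast D (fun a => col (D.longArc a)) c o}

/-- The colourings of (the short arcs of) `D` with `(B, f)`. -/
def VirtualColouring {B : Type*} (circ ast : B → B → B) (f : B ≃ B) (D : VirtualDiagram) :
    Type _ :=
  {col : D.ShortArc → B //
    (∀ c o, D.kind c = CrossingKind.classical o → ClassicalRule circ ast D col c o) ∧
    (∀ c, D.kind c = CrossingKind.virt → VirtualRule f D col c)}

end VirtualDiagram

/-! Suppose the short arcs carry integers `w` (an Alexander numbering) such that at each crossing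
both western arcs have number `n + 1` and both eastern arcs have number `n`. Replace the colour `x`
of an arc `a` by `f ^ w a` applied to `x`. The virtual rule becomes invariance, because `f ^ n (f x)
= f ^ (n + 1) x`, so the new colours live on long arcs. At a classical crossing `f ^ n` commutes
with the operations, and the surplus power of `f` on the western side is cancelled by the `f⁻¹` in
`twistOp`. Undoing the shift gives the inverse (`colouringEquiv`).

The numbering comes from planarity. In the space of real functions on edges, vertex and face
coboundaries are orthogonal, and Euler's formula makes them orthogonal complements. The constant
function 1 is orthogonal to vertex coboundaries, hence is a face coboundary
(`IsPlanar.exists_face_numbering`); each arc then takes the rounded number of the face on its left.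
-/

/-! ### Automorphisms -/

/-- The bijections that preserve a binary operation are closed under integer powers. -/
theorem zpow_map_op {B : Type*} (op : B → B → B) (f : Equiv.Perm B)
    (hf : ∀ x y, f (op x y) = op (f x) (f y)) (n : ℤ) (x y : B) :
    (f ^ n) (op x y) = op ((f ^ n) x) ((f ^ n) y) := by
  have hinv : ∀ x y, f⁻¹ (op x y) = op (f⁻¹ x) (f⁻¹ y) := fun x y => by
    rw [Equiv.Perm.inv_eq_iff_eq, hf]
    simp
  induction n generalizing x y with
  | zero => simp
  | succ n ih => simp only [zpow_add_one, Equiv.Perm.mul_apply, hf, ih]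
  | pred n ih => simp only [zpow_sub_one, Equiv.Perm.mul_apply, hinv, ih]

/-- The twist of a biquandle by an automorphism is a biquandle. -/
theorem IsVirtualBiquandle.isBiquandle_twistOp {B : Type*} {circ ast : B → B → B} {f : B ≃ B}
    (hB : IsVirtualBiquandle circ ast f) :
    IsBiquandle (twistOp f circ) (twistOp f ast) := by
  have h := hB.isBiquandle
  have hc : ∀ x y, f.symm (circ x y) = circ (f.symm x) (f.symm y) := fun x y => by
    rw [Equiv.symm_apply_eq, hB.map_circ]
    simp
  have ha : ∀ x y, f.symm (ast x y) = ast (f.symm x) (f.symm y) := fun x y => by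
    rw [Equiv.symm_apply_eq, hB.map_ast]
    simp
  -- The first axioms survive precomposition with `f⁻¹`; the exchange laws become the original ones
  -- at `f⁻² x`, `f⁻² y`, `f⁻² z`.
  refine ⟨fun x => h.diag _, fun y => (h.circ_bijective _).comp f.symm.bijective,
    fun y => (h.ast_bijective _).comp f.symm.bijective,
    h.pair_bijective.comp (f.symm.prodCongr f.symm).bijective, ?_, ?_, ?_⟩
  · intro x y z
    simp only [twistOp, hc, ha]
    exact h.exchange_circ_circ _ _ _
  · intro x y z
    simp only [twistOp, hc, ha]
    exact h.exchange_circ_ast _ _ _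
  · intro x y z
    simp only [twistOp, hc, ha]
    exact h.exchange_ast_ast _ _ _

/-! ### Potentials on planar curve maps -/

instance : Fintype Strand :=
  ⟨⟨[Strand.swne, Strand.senw], by simp⟩, by rintro ⟨⟩ <;> simp⟩

theorem Strand.sum_eq {M : Type*} [AddCommMonoid M] (g : Strand → M) :
    ∑ s, g s = g Strand.swne + g Strand.senw := by
  change (Multiset.map g (([Strand.swne, Strand.senw] : List Strand) : Multiset Strand)).sum = _
  simp

instance : Fintype StrandEnd :=
  ⟨⟨[StrandEnd.incoming, StrandEnd.outgoing], by simp⟩, by rintro ⟨⟩ <;> simp⟩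

namespace CurveMap

variable (G : CurveMap)

instance : Finite G.Crossing := G.finite

instance : Finite G.Face := Quot.finite _

instance : Finite G.GraphComponent := Quot.finite _

/-- The face to the right of a half-edge, seen from its crossing. -/
def face (d : G.Dart) : G.Face := Quot.mk _ d

theorem face_rotate_opposite (d : G.Dart) : G.face (G.rotate (G.opposite d)) = G.face d :=
  (Quot.sound (r := fun d e : G.Dart => e = G.rotate (G.opposite d)) rfl).symm

theorem opposite_opposite (d : G.Dart) : G.opposite (G.opposite d) = d := by
  obtain ⟨p, _ | _⟩ := d <;> simp [opposite]

/-- Both sides are the face to the left of `d`. -/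
theorem face_opposite (d : G.Dart) : G.face (G.opposite d) = G.face (G.rotate d) := by
  rw [← G.face_rotate_opposite (G.opposite d), opposite_opposite]

/-- The graph component of a crossing. -/
def component (c : G.Crossing) : G.GraphComponent := Quot.mk _ c

theorem component_next (p : G.Crossing × Strand) :
    G.component (G.next p).1 = G.component p.1 :=
  (Quot.sound ⟨p.2, (G.next p).2, rfl⟩).symm

theorem rotate_fst (d : G.Dart) : (G.rotate d).1.1 = d.1.1 := by
  obtain ⟨⟨c, _ | _⟩, _ | _⟩ := d <;> rfl

theorem component_opposite (d : G.Dart) :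
    G.component (G.opposite d).1.1 = G.component d.1.1 := by
  obtain ⟨p, _ | _⟩ := d
  · have := G.component_next (G.next.symm p)
    rw [Equiv.apply_symm_apply] at this
    exact this.symm
  · exact G.component_next p

/-- The graph component that a face belongs to. -/
def faceComponent : G.Face → G.GraphComponent :=
  Quot.lift (fun d => G.component d.1.1) (by
    rintro d _ rfl
    rw [rotate_fst, component_opposite])

/-- The difference of a function on crossings along the edges. -/
noncomputable def vertexCoboundary :
    (G.Crossing → ℝ) →ₗ[ℝ] EuclideanSpace ℝ (G.Crossing × Strand) where
  toFun k := WithLp.toLp 2 fun p => k (G.next p).1 - k p.1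
  map_add' k l := by
    ext p
    simp only [Pi.add_apply, PiLp.add_apply]
    ring
  map_smul' a k := by
    ext p
    simp only [Pi.smul_apply, PiLp.smul_apply, smul_eq_mul, RingHom.id_apply]
    ring

/-- The difference of a function on faces between the left and the right side of the edges. -/
noncomputable def faceCoboundary :
    (G.Face → ℝ) →ₗ[ℝ] EuclideanSpace ℝ (G.Crossing × Strand) where
  toFun h := WithLp.toLp 2 fun p =>
    h (G.face (G.next p, .incoming)) - h (G.face (p, .outgoing))
  map_add' k l := by
    ext p
    simp only [Pi.add_apply, PiLp.add_apply]
    ring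
  map_smul' a k := by
    ext p
    simp only [Pi.smul_apply, PiLp.smul_apply, smul_eq_mul, RingHom.id_apply]
    ring

theorem vertexCoboundary_apply (k : G.Crossing → ℝ) (p : G.Crossing × Strand) :
    G.vertexCoboundary k p = k (G.next p).1 - k p.1 := rfl

theorem faceCoboundary_apply (h : G.Face → ℝ) (p : G.Crossing × Strand) :
    G.faceCoboundary h p =
      h (G.face (G.next p, .incoming)) - h (G.face (p, .outgoing)) := rfl

theorem finrank_range_funLeft_le {α β : Type*} [Finite β] (g : α → β) :
    Module.finrank ℝ (LinearMap.range (LinearMap.funLeft ℝ ℝ g)) ≤ Nat.card β := by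
  have := Fintype.ofFinite β
  refine (LinearMap.finrank_range_le _).trans ?_
  rw [Module.finrank_fintype_fun_eq_card, Nat.card_eq_fintype_card]

/-- A function without jumps along edges is constant on components. This inclusion suffices, since
only an upper bound on the kernel's dimension is needed. -/
theorem ker_vertexCoboundary_le :
    LinearMap.ker G.vertexCoboundary ≤ LinearMap.range (LinearMap.funLeft ℝ ℝ G.component) := by
  intro k hk
  have hk' : ∀ p, k (G.next p).1 = k p.1 := fun p => by
    have := congrArg (fun v => v p) (LinearMap.mem_ker.mp hk)
    exact sub_eq_zero.mp this
  refine ⟨Quot.lift k ?_, rfl⟩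
  rintro c d ⟨s, t, h⟩
  have := hk' (c, s)
  rw [h] at this
  exact this.symm

theorem ker_faceCoboundary_le :
    LinearMap.ker G.faceCoboundary ≤
      LinearMap.range (LinearMap.funLeft ℝ ℝ G.faceComponent) := by
  intro h hh
  have h1 : ∀ p, h (G.face (G.next p, .incoming)) = h (G.face (p, .outgoing)) := fun p => by
    have := congrArg (fun v => v p) (LinearMap.mem_ker.mp hh)
    exact sub_eq_zero.mp this
  have hopp : ∀ d, h (G.face (G.opposite d)) = h (G.face d) := by
    rintro ⟨p, _ | _⟩
    · have := h1 (G.next.symm p)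
      rw [Equiv.apply_symm_apply] at this
      exact this.symm
    · exact h1 p
  -- Turning to the next corner of a crossing means stepping across an edge, so all four corners
  -- have the same value.
  have hrot : ∀ d, h (G.face (G.rotate d)) = h (G.face d) := fun d => by
    rw [← face_opposite, hopp]
  have hbase : ∀ d : G.Dart, h (G.face d) = h (G.face ((d.1.1, .swne), .incoming)) := by
    rintro ⟨⟨c, s⟩, e⟩
    have a1 := hrot ((c, .swne), .incoming)
    have a2 := hrot ((c, .senw), .incoming)
    have a3 := hrot ((c, .swne), .outgoing)
    simp only [rotate] at a1 a2 a3
    cases s <;> cases e <;> simp only [a1, a2, a3]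
  refine ⟨Quot.lift (fun c => h (G.face ((c, .swne), .incoming))) ?_, ?_⟩
  · rintro c d ⟨s, t, e⟩
    have := h1 (c, s)
    rw [e, hbase, hbase ((c, s), _)] at this
    exact this.symm
  · funext x
    induction x using Quot.ind with
    | mk d => exact (hbase d).symm

theorem sum_vertexCoboundary [Fintype G.Crossing] (k : G.Crossing → ℝ) :
    ∑ p, G.vertexCoboundary k p = 0 := by
  simp only [vertexCoboundary_apply, Finset.sum_sub_distrib]
  rw [Equiv.sum_comp G.next (fun p => k p.1), sub_self]

/-- Summation by parts: the coefficient of each `k c` is a sum of face differences once around the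
crossing, which telescopes to zero. -/
theorem sum_vertexCoboundary_mul_faceCoboundary [Fintype G.Crossing] (k : G.Crossing → ℝ)
    (h : G.Face → ℝ) :
    ∑ p, G.vertexCoboundary k p * G.faceCoboundary h p = 0 := by
  have e1 : ∀ p, G.faceCoboundary h p =
      h (G.face (G.next p, .incoming)) - h (G.face (G.rotate (G.next p, .incoming))) := by
    intro p
    rw [← face_opposite, faceCoboundary_apply]
    simp [opposite]
  have e2 : ∀ p, G.faceCoboundary h p =
      h (G.face (G.rotate (p, .outgoing))) - h (G.face (p, .outgoing)) := by
    intro p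
    rw [← face_opposite, faceCoboundary_apply]
    simp [opposite]
  have e3 : ∑ p, k (G.next p).1 * G.faceCoboundary h p =
      ∑ p : G.Crossing × Strand, k p.1 *
        (h (G.face (p, .incoming)) - h (G.face (G.rotate (p, .incoming)))) := by
    simp only [e1]
    exact Equiv.sum_comp G.next (fun p => k p.1 *
      (h (G.face (p, .incoming)) - h (G.face (G.rotate (p, .incoming)))))
  simp only [vertexCoboundary_apply, sub_mul, Finset.sum_sub_distrib]
  rw [e3]
  simp only [e2]
  rw [← Finset.sum_sub_distrib, Fintype.sum_prod_type]
  refine Finset.sum_eq_zero fun c _ => ?_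
  rw [Strand.sum_eq]
  simp only [rotate]
  ring

variable {G}

/-- On a planar curve map, a function on the edges is the coboundary of a function on the faces
as soon as it is orthogonal to the coboundaries of the functions on the crossings. -/
theorem IsPlanar.orthogonal_le_range_faceCoboundary [Fintype G.Crossing] (hG : G.IsPlanar) :
    (LinearMap.range G.vertexCoboundary)ᗮ ≤ LinearMap.range G.faceCoboundary := by
  have := Fintype.ofFinite G.Face
  have hle : LinearMap.range G.faceCoboundary ≤ (LinearMap.range G.vertexCoboundary)ᗮ := by
    rintro _ ⟨h, rfl⟩
    rw [Submodule.mem_orthogonal]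
    rintro _ ⟨k, rfl⟩
    rw [← sum_vertexCoboundary_mul_faceCoboundary G k h]
    simp [PiLp.inner_apply, mul_comm]
  -- The ranges have dimensions at least `V - C` and `F - C`, and these add up to `E` by Euler's
  -- formula.
  refine (Submodule.eq_of_le_of_finrank_le hle ?_).ge
  have i1 := G.vertexCoboundary.finrank_range_add_finrank_ker
  have i2 := G.faceCoboundary.finrank_range_add_finrank_ker
  have i3 := (Submodule.finrank_mono G.ker_vertexCoboundary_le).trans
    (finrank_range_funLeft_le _)
  have i4 := (Submodule.finrank_mono G.ker_faceCoboundary_le).trans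
    (finrank_range_funLeft_le _)
  have i5 := (LinearMap.range G.vertexCoboundary).finrank_add_finrank_orthogonal
  rw [Module.finrank_fintype_fun_eq_card, ← Nat.card_eq_fintype_card] at i1 i2
  rw [finrank_euclideanSpace, ← Nat.card_eq_fintype_card] at i5
  unfold IsPlanar at hG
  omega

/-- An Alexander numbering of the faces with real values: along every edge the number of the left
face exceeds that of the right face by one. -/
theorem IsPlanar.exists_face_numbering (hG : G.IsPlanar) :
    ∃ h : G.Face → ℝ, ∀ p,
      h (G.face (G.next p, .incoming)) = h (G.face (p, .outgoing)) + 1 := by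
  have := Fintype.ofFinite G.Crossing
  have h1 : (WithLp.toLp 2 fun _ => 1 : EuclideanSpace ℝ (G.Crossing × Strand)) ∈
      (LinearMap.range G.vertexCoboundary)ᗮ := by
    rw [Submodule.mem_orthogonal]
    rintro _ ⟨k, rfl⟩
    -- The inner product with the constant 1 is the sum over all edges.
    rw [← sum_vertexCoboundary G k]
    simp [PiLp.inner_apply]
  obtain ⟨h, hh⟩ := hG.orthogonal_le_range_faceCoboundary h1
  refine ⟨h, fun p => ?_⟩
  have := congrArg (fun v => v p) hh
  simp only [faceCoboundary_apply] at this
  linarith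

end CurveMap

/-! ### Alexander numberings of arcs and shifted colourings -/

namespace VirtualDiagram

/-- An Alexander numbering of the short arcs: it drops by one from the western to the eastern
parts of the strands at each crossing. -/
theorem exists_arc_numbering (D : VirtualDiagram) :
    ∃ w : D.ShortArc → ℤ, ∀ c s t, w (D.east c s) + 1 = w (D.west c t) := by
  obtain ⟨h, hh⟩ := D.planar.exists_face_numbering
  have hW : ∀ c, h (D.face (D.next (c, .senw), .incoming)) =
      h (D.face ((c, .swne), .incoming)) := fun c =>
    congrArg h (D.face_opposite ((c, .senw), .outgoing))
  have hN : ∀ c, h (D.face (D.next (c, .swne), .incoming)) =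
      h (D.face ((c, .senw), .outgoing)) := fun c =>
    congrArg h (D.face_opposite ((c, .swne), .outgoing))
  have hS : ∀ c, h (D.face (D.next.symm (c, .swne), .outgoing)) =
      h (D.face ((c, .senw), .incoming)) := fun c =>
    congrArg h (D.face_opposite ((c, .swne), .incoming))
  -- An arc takes the number of its left face: west for both western arcs, north or south for the
  -- eastern ones. Floors preserve steps of one; circles meet no crossing, so 0 is arbitrary.
  refine ⟨Sum.elim (fun p => ⌊h (D.face (D.next p, .incoming))⌋) (fun _ => 0), ?_⟩
  intro c s t
  have h1 := hh (c, .senw)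
  have h2 := hh (D.next.symm (c, .swne))
  rw [hS, Equiv.apply_symm_apply] at h2
  rw [hW] at h1
  cases s <;> cases t <;>
    simp only [east, west, inArc, outArc, Sum.elim_inl, Equiv.apply_symm_apply, hW, hN] <;>
    rw [← Int.floor_add_one]
  · rw [h1]
  · rw [h1]
  · rw [h2]
  · rw [h2]

variable {B : Type*} {circ ast : B → B → B} {f : B ≃ B} {D : VirtualDiagram}

/-- Shifting the colours by powers of the automorphism given by an Alexander numbering turns the
classical rule into the classical rule for the twisted operations. -/
theorem classicalRule_shift_iff (hB : IsVirtualBiquandle circ ast f) {w : D.ShortArc → ℤ}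
    (hw : ∀ c s t, w (D.east c s) + 1 = w (D.west c t)) (col : D.ShortArc → B)
    (c : D.Crossing) (o : Strand) :
    ClassicalRule (twistOp f circ) (twistOp f ast) D
      (fun a => ((f : Equiv.Perm B) ^ w a) (col a)) c o ↔ ClassicalRule circ ast D col c o := by
  have hwest : ∀ s x, f.symm (((f : Equiv.Perm B) ^ w (D.west c s)) x) =
      ((f : Equiv.Perm B) ^ w (D.east c o)) x := fun s x => by
    rw [Equiv.symm_apply_eq, ← hw c o s, add_comm, zpow_one_add]
    rfl
  have heast : w (D.east c o.other) = w (D.east c o) :=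
    add_right_cancel ((hw c o.other o).trans (hw c o o).symm)
  simp only [ClassicalRule, twistOp, hwest, heast]
  rw [← zpow_map_op circ f hB.map_circ, ← zpow_map_op ast f hB.map_ast, Equiv.apply_eq_iff_eq,
    Equiv.apply_eq_iff_eq]

/-- Shifting the colours by powers of the automorphism given by an Alexander numbering turns the
virtual rule into the rule that colours do not change. -/
theorem virtualRule_iff_shift {w : D.ShortArc → ℤ}
    (hw : ∀ c s t, w (D.east c s) + 1 = w (D.west c t)) (col : D.ShortArc → B)
    (c : D.Crossing) :
    VirtualRule f D col c ↔ ∀ s, ((f : Equiv.Perm B) ^ w (D.inArc c s)) (col (D.inArc c s)) =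
      ((f : Equiv.Perm B) ^ w (D.outArc c s)) (col (D.outArc c s)) := by
  have key : ∀ s, col (D.east c s) = f (col (D.west c s)) ↔
      ((f : Equiv.Perm B) ^ w (D.west c s)) (col (D.west c s)) =
        ((f : Equiv.Perm B) ^ w (D.east c s)) (col (D.east c s)) := fun s => by
    rw [← hw c s s, zpow_add_one, Equiv.Perm.mul_apply, Equiv.apply_eq_iff_eq, eq_comm]
  refine forall_congr' fun s => (key s).trans ?_
  -- The incoming arc is western for `swne` but eastern for `senw`, which flips the equation.
  cases s
  · rfl
  · exact eq_comm

/-- The bijection of colourings given by an Alexander numbering of the short arcs. -/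
def colouringEquiv (hB : IsVirtualBiquandle circ ast f) (w : D.ShortArc → ℤ)
    (hw : ∀ c s t, w (D.east c s) + 1 = w (D.west c t)) :
    D.VirtualColouring circ ast f ≃ D.Colouring (twistOp f circ) (twistOp f ast) where
  toFun col := ⟨Quot.lift (fun a => ((f : Equiv.Perm B) ^ w a) (col.1 a)) (by
      rintro _ _ ⟨c, s, hc, rfl, rfl⟩
      exact (virtualRule_iff_shift hw col.1 c).mp (col.2.2 c hc) s),
    fun c o hc => (classicalRule_shift_iff hB hw col.1 c o).mpr (col.2.1 c o hc)⟩
  invFun col := ⟨fun a => ((f : Equiv.Perm B) ^ w a).symm (col.1 (D.longArc a)), by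
    refine ⟨fun c o hc => ?_, fun c hc => ?_⟩
    · rw [← classicalRule_shift_iff hB hw]
      simp only [Equiv.apply_symm_apply]
      exact col.2 c o hc
    · rw [virtualRule_iff_shift hw]
      intro s
      simp only [Equiv.apply_symm_apply]
      exact congrArg col.1 (Quot.sound ⟨c, s, hc, rfl, rfl⟩)⟩
  left_inv col := Subtype.ext (funext fun a => Equiv.symm_apply_apply _ _)
  right_inv col := Subtype.ext (funext fun a => by
    induction a using Quot.ind with
    | mk a => exact Equiv.apply_symm_apply _ _)

end VirtualDiagram

theorem mainTheorem4 {B : Type*} (circ ast : B → B → B) (f : B ≃ B)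
    (hB : IsVirtualBiquandle circ ast f) :
    IsBiquandle (twistOp f circ) (twistOp f ast) ∧
      ∀ D : VirtualDiagram,
        Nonempty (D.VirtualColouring circ ast f ≃
          D.Colouring (twistOp f circ) (twistOp f ast)) := by
  refine ⟨hB.isBiquandle_twistOp, fun D => ?_⟩
  obtain ⟨w, hw⟩ := D.exists_arc_numbering
  exact ⟨VirtualDiagram.colouringEquiv hB w hw⟩
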